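/- Let $m>d\ge 0$ be integers and let $A=(A_1,\dots,A_m)$ be an $m$-tuple of vectors in $\mathbb R^d$. For $I\subset[m]=\{1,\dots,m\}$ let $\mathrm{conv}\,A(I)$ be the convex hull of $\{A_i : i\in I\}$. Assume that $A$ is admissible, i.e. $\mathbf 0\in\mathrm{conv}\,A([m])$, and $\mathbf 0\in\mathrm{conv}\,A(I)$ implies $\mathrm{card}(I)>d$; assume also that its centroid is at the origin, $\sum_{i=1}^m A_i=\mathbf 0$. For $z\in\mathbb C^m$ and $T\in\mathbb R^d$ put $F(z,T)=(z_ie^{\langle A_i,T\rangle})_{i=1}^m$, let $L_z=\{F(z,T) : T\in\mathbb R^d\}$ be the leaf through $z$, and let $I_z=\{i : z_i\ne 0\}$. Put $$\mathcal S_A=\{z\in\mathbb C^m : \mathbf 0\in\mathrm{conv}\,A(I_z)\},\qquad K_A=\{\sigma\subset[m] : \mathbf 0\in\mathrm{conv}\,A([m]\setminus\sigma)\},$$ $$X_A(2)=\Big\{z\in\mathbb C^m : \sum_{i=1}^m A_i|z_i|^2=\mathbf 0,\ \|z\|_2=1\Big\},$$ $$(D^2,S^1)^{K_A}=\bigcup_{\sigma\in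 K_A}\{z\in\mathbb C^m : |z_i|\le 1 \text{ for } i\in\sigma,\ |z_i|=1\text{ for } i\notin\sigma\}.$$ Then for each $z\in\mathcal S_A$ the leaf $L_z$ contains a unique point $f_2(z)$ of minimal $L^2$-norm, this norm is positive, and $L_z$ contains a unique point $f_\infty(z)$ such that $f_\infty(z)/\|f_\infty(z)\|_\infty\in(D^2,S^1)^{K_A}$. Moreover $(D^2,S^1)^{K_A}\subset\mathcal S_A$, and: 1. the restriction of $f_2/\|f_2\|_2$ to $(D^2,S^1)^{K_A}$ is a homeomorphism onto $X_A(2)$, whose inverse is the restriction of $f_\infty/\|f_\infty\|_\infty$ to $X_A(2)$; 2. the map $\Phi_A(\infty)\colon (D^2,S^1)^{K_A}\times\mathbb R^d\times\mathbb R_{>0}\to\mathcal S_A$, $(z,T,r)\mapsto r\,(z_ie^{\langle A_i,T\rangle})_{i=1}^m$, is a homeomorphism. -/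

import Mathlib

noncomputable section

namespace SiegelLeaves

variable {m d : ℕ}

/-- The convex hull `conv A(I)` of the subtuple of `A` indexed by `I`. -/
def conv (A : Fin m → EuclideanSpace ℝ (Fin d)) (I : Finset (Fin m)) :
    Set (EuclideanSpace ℝ (Fin d)) :=
  convexHull ℝ (A '' (I : Set (Fin m)))

/-- A tuple is admissible when it satisfies the Siegel condition and the weak hyperbolicity
condition. -/
structure Admissible (A : Fin m → EuclideanSpace ℝ (Fin d)) : Prop where
  siegel : (0 : EuclideanSpace ℝ (Fin d)) ∈ conv A Finset.univ
  weakHyperbolicity : ∀ I : Finset (Fin m),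
    (0 : EuclideanSpace ℝ (Fin d)) ∈ conv A I → d < I.card

/-- A tuple is centered at the origin when its centroid is the origin. -/
def Centered (A : Fin m → EuclideanSpace ℝ (Fin d)) : Prop :=
  ∑ i, A i = 0

/-- The action `F(z, T) = (z_i e^{⟨A_i, T⟩})_i` of `ℝ^d` on `ℂ^m`. -/
def flow (A : Fin m → EuclideanSpace ℝ (Fin d)) (z : EuclideanSpace ℂ (Fin m))
    (T : EuclideanSpace ℝ (Fin d)) : EuclideanSpace ℂ (Fin m) :=
  WithLp.toLp 2 fun i => z i * ((Real.exp (inner ℝ (A i) T) : ℝ) : ℂ)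

/-- The leaf `L_z`, i.e. the orbit of `z`. -/
def leaf (A : Fin m → EuclideanSpace ℝ (Fin d)) (z : EuclideanSpace ℂ (Fin m)) :
    Set (EuclideanSpace ℂ (Fin m)) :=
  Set.range (flow A z)

/-- The index set `I_z` of the non-zero entries of `z`. -/
def nonzeroIndices (z : EuclideanSpace ℂ (Fin m)) : Finset (Fin m) :=
  {i | z i ≠ 0}

/-- The set `S_A` of all `z` with `0 ∈ conv A(I_z)`. -/
def siegelSet (A : Fin m → EuclideanSpace ℝ (Fin d)) : Set (EuclideanSpace ℂ (Fin m)) :=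
  {z | (0 : EuclideanSpace ℝ (Fin d)) ∈ conv A (nonzeroIndices z)}

/-- The link `X_A(2)`. -/
def link (A : Fin m → EuclideanSpace ℝ (Fin d)) : Set (EuclideanSpace ℂ (Fin m)) :=
  {z | ∑ i, ‖z i‖ ^ 2 • A i = 0 ∧ ‖z‖ = 1}

/-- The simplicial complex `K_A` on the index set; the empty simplex may belong to it, and
not every index need be a vertex. -/
def complex (A : Fin m → EuclideanSpace ℝ (Fin d)) : Set (Finset (Fin m)) :=
  {σ | (0 : EuclideanSpace ℝ (Fin d)) ∈ conv A σᶜ}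

/-- The moment-angle complex `(D², S¹)^K`, as a subset of `ℂ^m`. -/
def momentAngle (K : Set (Finset (Fin m))) : Set (EuclideanSpace ℂ (Fin m)) :=
  ⋃ σ ∈ K, {z | ∀ i, (i ∈ σ → ‖z i‖ ≤ 1) ∧ (i ∉ σ → ‖z i‖ = 1)}

/-- `w` is a point of the leaf `L_z` whose Euclidean norm is minimal in that leaf. -/
def IsNormMin (A : Fin m → EuclideanSpace ℝ (Fin d)) (z w : EuclideanSpace ℂ (Fin m)) : Prop :=
  w ∈ leaf A z ∧ ∀ y ∈ leaf A z, ‖w‖ ≤ ‖y‖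

/-- `f_2(z)`: the point of minimal Euclidean norm of the leaf `L_z` (for `z ∈ S_A`). -/
def normMin (A : Fin m → EuclideanSpace ℝ (Fin d)) (z : EuclideanSpace ℂ (Fin m)) :
    EuclideanSpace ℂ (Fin m) :=
  Classical.epsilon (IsNormMin A z)

/-- The maximum norm on `ℂ^m`. -/
def maxNorm (z : EuclideanSpace ℂ (Fin m)) : ℝ :=
  ⨆ i, ‖z i‖

/-- `w` is a point of the leaf `L_z` with `w / ‖w‖_∞` in the moment-angle complex of `K_A`. -/
def IsMomentAnglePoint (A : Fin m → EuclideanSpace ℝ (Fin d))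
    (z w : EuclideanSpace ℂ (Fin m)) : Prop :=
  w ∈ leaf A z ∧ (maxNorm w)⁻¹ • w ∈ momentAngle (complex A)

/-- `f_∞(z)`: the point `w` of the leaf `L_z` with `w / ‖w‖_∞ ∈ (D², S¹)^{K_A}`
(for `z ∈ S_A`). -/
def momentAnglePoint (A : Fin m → EuclideanSpace ℝ (Fin d)) (z : EuclideanSpace ℂ (Fin m)) :
    EuclideanSpace ℂ (Fin m) :=
  Classical.epsilon (IsMomentAnglePoint A z)

end SiegelLeaves

end

/-!
Weak hyperbolicity enters through one consequence of Carathéodory's theorem: if `0 ∈ conv A(I)`,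
then for every `T ≠ 0` some `i ∈ I` satisfies `⟨A_i, T⟩ > 0` (`Admissible.exists_inner_pos`). By
compactness of the sphere this becomes uniform: some `⟨A_i, T⟩ ≥ δ ‖T‖` with `i ∈ I`, where `δ > 0`
depends on `A` only (`Admissible.exists_mul_norm_le_inner`).

Both the Euclidean norm and the maximum norm are therefore coercive along a leaf in `S_A` and attain
a minimum there (`Admissible.exists_flow_isMin`). The first-order condition at a minimum says that
the point, divided by its norm, lies in the link for the Euclidean norm, and in the moment-angle
complex for the maximum norm (`inv_norm_smul_mem_link`, `inv_maxNorm_smul_mem_momentAngle`).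
Conversely each norm strictly grows along the leaf away from such a point
(`Admissible.norm_lt_norm_flow`, `Admissible.maxNorm_lt_maxNorm_flow`), so the link and the
moment-angle complex each meet every class `{r F(z, T) | T ∈ ℝ^d, r > 0}` in `S_A` exactly once, in
the normalised points `f_2(z)` and `f_∞(z)`. This gives existence and uniqueness of `f_2` and `f_∞`,
the bijectivity of `Φ_A(∞)`, and the two mutually inverse bijections between the link and the
moment-angle complex.

For the topology, the uniform estimate bounds `T`, `r` and `r⁻¹` locally uniformly in terms of
`r F(u, T)` (`Admissible.eventually_bounded`); since the moment-angle complex is compact, `Φ_A(∞)`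
is proper, hence a homeomorphism. Its inverse followed by the projection to the moment-angle complex is
`f_∞ / ‖f_∞‖_∞`, which is thus continuous on the link, and a continuous bijection from the compact
link to a Hausdorff space is a homeomorphism. In this way no continuity of `f_2` has to be proved
separately.
-/

namespace SiegelLeaves

open Filter Topology

/-! ### Convex hulls of subtuples -/

section Convexity

variable {m d : ℕ} {A : Fin m → EuclideanSpace ℝ (Fin d)}

theorem conv_mono (A : Fin m → EuclideanSpace ℝ (Fin d)) {I J : Finset (Fin m)} (h : I ⊆ J) :
    conv A I ⊆ conv A J :=
  convexHull_mono (Set.image_mono (Finset.coe_subset.2 h))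

theorem nonempty_of_zero_mem_conv {I : Finset (Fin m)} (h : 0 ∈ conv A I) : I.Nonempty := by
  by_contra hI
  rw [Finset.not_nonempty_iff_eq_empty] at hI
  simp [hI, conv] at h

theorem zero_mem_conv_of_sum {I : Finset (Fin m)} {w : Fin m → ℝ} (hw : ∀ i ∈ I, 0 ≤ w i)
    (h1 : ∑ i ∈ I, w i = 1) (h0 : ∑ i ∈ I, w i • A i = 0) : 0 ∈ conv A I := by
  rw [← h0]
  exact (convex_convexHull ℝ _).sum_mem hw h1
    fun i hi => subset_convexHull ℝ _ ⟨i, hi, rfl⟩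

/-- Were `⟨A_i, T⟩ ≤ 0` on all of `I`, a convex combination representing `0` would live in the
hyperplane orthogonal to `T`, where by Carathéodory's theorem it needs at most `d` points; this is
what weak hyperbolicity forbids. -/
theorem Admissible.exists_inner_pos (hA : Admissible A) {I : Finset (Fin m)} (hI : 0 ∈ conv A I)
    {T : EuclideanSpace ℝ (Fin d)} (hT : T ≠ 0) : ∃ i ∈ I, 0 < inner ℝ (A i) T := by
  by_contra! hneg
  obtain ⟨ι, _, z, w, hz, hind, hw, hw1, hw0⟩ := eq_pos_convex_span_of_mem_convexHull hI
  have hzI : ∀ k, ∃ i, i ∈ I ∧ A i = z k := fun k => by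
    obtain ⟨i, hi, h⟩ := hz ⟨k, rfl⟩
    exact ⟨i, hi, h⟩
  choose f hfI hf using hzI
  have hle : ∀ k, w k * inner ℝ (z k) T ≤ 0 := fun k =>
    mul_nonpos_of_nonneg_of_nonpos (hw k).le (hf k ▸ hneg _ (hfI k))
  have hsum : ∑ k, w k * inner ℝ (z k) T = 0 := by
    have := congrArg (fun x => inner ℝ x T) hw0
    simpa [sum_inner, inner_smul_left] using this
  have horth : ∀ k, inner ℝ (z k) T = 0 := fun k => by
    have := (Finset.sum_eq_zero_iff_of_nonpos fun k _ => hle k).1 hsum k (Finset.mem_univ k)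
    exact (mul_eq_zero.1 this).resolve_left (hw k).ne'
  have hcard : Fintype.card ι ≤ d := by
    have hspan : vectorSpan ℝ (Set.range z) ≤ (ℝ ∙ T)ᗮ := by
      rw [vectorSpan_def, Submodule.span_le]
      rintro _ ⟨_, ⟨k, rfl⟩, _, ⟨l, rfl⟩, rfl⟩
      simp [Submodule.mem_orthogonal_singleton_iff_inner_left, inner_sub_left, horth]
    have hlt : vectorSpan ℝ (Set.range z) < ⊤ := by
      refine lt_of_le_of_lt hspan (lt_top_iff_ne_top.2 fun h => hT ?_)
      have : T ∈ (ℝ ∙ T)ᗮ := h ▸ Submodule.mem_top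
      rw [Submodule.mem_orthogonal_singleton_iff_inner_left] at this
      exact inner_self_eq_zero.1 this
    have h1 := hind.card_le_finrank_succ
    have h2 := Submodule.finrank_lt hlt.ne
    rw [finrank_euclideanSpace_fin] at h2
    omega
  have hmem : (0 : EuclideanSpace ℝ (Fin d)) ∈ conv A (Finset.univ.image f) := by
    rw [← hw0]
    refine (convex_convexHull ℝ _).sum_mem (fun k _ => (hw k).le) hw1 fun k _ => ?_
    exact subset_convexHull ℝ _ ⟨f k, by simp, hf k⟩
  have h1 := hA.weakHyperbolicity _ hmem
  have h2 : (Finset.univ.image f).card ≤ Fintype.card ι := Finset.card_image_le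
  omega

theorem exists_inner_neg_of_zero_notMem_conv {I : Finset (Fin m)} (hI : 0 ∉ conv A I) :
    ∃ S, ∀ i ∈ I, inner ℝ (A i) S < 0 := by
  obtain ⟨f, u, hu, hf⟩ := geometric_hahn_banach_point_closed (convex_convexHull ℝ (A '' I))
    ((I.finite_toSet.image A).isClosed_convexHull ℝ) hI
  refine ⟨-(InnerProductSpace.toDual ℝ _).symm f, fun i hi => ?_⟩
  have h := hf (A i) (subset_convexHull ℝ _ ⟨i, hi, rfl⟩)
  rw [map_zero] at hu
  rw [inner_neg_right, real_inner_comm, InnerProductSpace.toDual_symm_apply]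
  linarith

/-- Compactness of the unit sphere makes `Admissible.exists_inner_pos` quantitative. -/
theorem Admissible.exists_mul_norm_le_inner_of_mem_conv (hA : Admissible A) {I : Finset (Fin m)}
    (hI : 0 ∈ conv A I) :
    ∃ δ > 0, ∀ T, ∃ i ∈ I, δ * ‖T‖ ≤ inner ℝ (A i) T := by
  have hne := nonempty_of_zero_mem_conv hI
  let g : EuclideanSpace ℝ (Fin d) → ℝ := fun T => I.sup' hne fun i => inner ℝ (A i) T
  have hg : Continuous g := Continuous.finset_sup'_apply hne fun i _ => by fun_prop
  obtain hS | hS := (Metric.sphere (0 : EuclideanSpace ℝ (Fin d)) 1).eq_empty_or_nonempty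
  · have hT : ∀ T : EuclideanSpace ℝ (Fin d), T = 0 := fun T => by
      by_contra hT
      have : (‖T‖⁻¹ • T) ∈ Metric.sphere (0 : EuclideanSpace ℝ (Fin d)) 1 := by
        simp [norm_smul, hT]
      simp [hS] at this
    obtain ⟨i, hi⟩ := hne
    exact ⟨1, one_pos, fun T => ⟨i, hi, by simp [hT T]⟩⟩
  · obtain ⟨S, hS1, hS⟩ := (isCompact_sphere _ _).exists_isMinOn hS hg.continuousOn
    refine ⟨g S, ?_, fun T => ?_⟩
    · have hS0 : S ≠ 0 := by
        rintro rfl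
        simp at hS1
      obtain ⟨i, hi, h⟩ := hA.exists_inner_pos hI hS0
      exact h.trans_le (Finset.le_sup' (fun i => inner ℝ (A i) S) hi)
    · obtain rfl | hT := eq_or_ne T 0
      · obtain ⟨i, hi⟩ := hne
        exact ⟨i, hi, by simp⟩
      · have hT1 : (‖T‖⁻¹ • T) ∈ Metric.sphere (0 : EuclideanSpace ℝ (Fin d)) 1 := by
          simp [norm_smul, hT]
        obtain ⟨i, hi, h⟩ := Finset.exists_mem_eq_sup' hne fun i => inner ℝ (A i) (‖T‖⁻¹ • T)
        have h2 : g S ≤ inner ℝ (A i) (‖T‖⁻¹ • T) := (isMinOn_iff.1 hS _ hT1).trans h.le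
        rw [inner_smul_right, inv_mul_eq_div, le_div_iff₀ (norm_pos_iff.2 hT)] at h2
        exact ⟨i, hi, h2⟩

theorem Admissible.exists_mul_norm_le_inner (hA : Admissible A) :
    ∃ δ > 0, ∀ I, 0 ∈ conv A I → ∀ T, ∃ i ∈ I, δ * ‖T‖ ≤ inner ℝ (A i) T := by
  have : ∀ I : Finset (Fin m), ∃ δ : ℝ, 0 < δ ∧
      (0 ∈ conv A I → ∀ T, ∃ i ∈ I, δ * ‖T‖ ≤ inner ℝ (A i) T) := fun I => by
    by_cases hI : 0 ∈ conv A I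
    · obtain ⟨δ, h0, h⟩ := hA.exists_mul_norm_le_inner_of_mem_conv hI
      exact ⟨δ, h0, fun _ => h⟩
    · exact ⟨1, one_pos, fun h => absurd h hI⟩
  choose δ h0 h using this
  obtain ⟨I₀, hI₀⟩ := Finite.exists_min δ
  refine ⟨δ I₀, h0 _, fun I hI T => ?_⟩
  obtain ⟨i, hi, hiT⟩ := h I hI T
  exact ⟨i, hi, (mul_le_mul_of_nonneg_right (hI₀ I) (norm_nonneg T)).trans hiT⟩

end Convexity

/-! ### The flow and the maximum norm -/

section Flow

variable {m d : ℕ} {A : Fin m → EuclideanSpace ℝ (Fin d)}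

@[simp]
theorem flow_apply (A : Fin m → EuclideanSpace ℝ (Fin d)) (z : EuclideanSpace ℂ (Fin m))
    (T : EuclideanSpace ℝ (Fin d)) (i : Fin m) :
    flow A z T i = z i * ((Real.exp (inner ℝ (A i) T) : ℝ) : ℂ) :=
  rfl

theorem norm_flow_apply (A : Fin m → EuclideanSpace ℝ (Fin d)) (z : EuclideanSpace ℂ (Fin m))
    (T : EuclideanSpace ℝ (Fin d)) (i : Fin m) :
    ‖flow A z T i‖ = ‖z i‖ * Real.exp (inner ℝ (A i) T) := by
  rw [flow_apply, norm_mul, Complex.norm_of_nonneg (Real.exp_pos _).le]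

@[simp]
theorem flow_zero (z : EuclideanSpace ℂ (Fin m)) : flow A z 0 = z := by
  ext i
  simp

theorem flow_flow (z : EuclideanSpace ℂ (Fin m)) (S T : EuclideanSpace ℝ (Fin d)) :
    flow A (flow A z S) T = flow A z (S + T) := by
  ext i
  simp only [flow_apply, inner_add_right, Real.exp_add, Complex.ofReal_mul, mul_assoc]

theorem flow_smul (r : ℝ) (z : EuclideanSpace ℂ (Fin m)) (T : EuclideanSpace ℝ (Fin d)) :
    flow A (r • z) T = r • flow A z T := by
  ext i
  simp [mul_assoc]

theorem continuous_flow (A : Fin m → EuclideanSpace ℝ (Fin d)) :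
    Continuous fun p : EuclideanSpace ℂ (Fin m) × EuclideanSpace ℝ (Fin d) => flow A p.1 p.2 := by
  refine (PiLp.continuous_toLp 2 _).comp (continuous_pi fun i => ?_)
  fun_prop

theorem mem_nonzeroIndices {z : EuclideanSpace ℂ (Fin m)} {i : Fin m} :
    i ∈ nonzeroIndices z ↔ z i ≠ 0 := by
  simp [nonzeroIndices]

theorem smul_flow_mem_siegelSet {z : EuclideanSpace ℂ (Fin m)} (hz : z ∈ siegelSet A)
    (T : EuclideanSpace ℝ (Fin d)) {r : ℝ} (hr : 0 < r) : r • flow A z T ∈ siegelSet A := by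
  refine conv_mono A (fun i hi => ?_) hz
  rw [mem_nonzeroIndices] at hi ⊢
  simp [hi, hr.ne']

theorem norm_apply_le_maxNorm (z : EuclideanSpace ℂ (Fin m)) (i : Fin m) :
    ‖z i‖ ≤ maxNorm z :=
  le_ciSup (f := fun i => ‖z i‖) (Set.finite_range _).bddAbove i

theorem exists_norm_apply_eq_maxNorm (hm : 0 < m) (z : EuclideanSpace ℂ (Fin m)) :
    ∃ i, ‖z i‖ = maxNorm z :=
  have : Nonempty (Fin m) := ⟨⟨0, hm⟩⟩
  exists_eq_ciSup_of_finite

theorem maxNorm_eq_norm_ofLp (z : EuclideanSpace ℂ (Fin m)) : maxNorm z = ‖z.ofLp‖ := by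
  refine le_antisymm (Real.iSup_le (fun i => norm_le_pi_norm z.ofLp i) (norm_nonneg _)) ?_
  exact (pi_norm_le_iff_of_nonneg (Real.iSup_nonneg fun i => norm_nonneg _)).2
    (norm_apply_le_maxNorm z)

theorem continuous_maxNorm : Continuous (maxNorm (m := m)) := by
  simp_rw [funext maxNorm_eq_norm_ofLp]
  exact (PiLp.continuous_ofLp 2 _).norm

theorem maxNorm_smul {r : ℝ} (hr : 0 ≤ r) (z : EuclideanSpace ℂ (Fin m)) :
    maxNorm (r • z) = r * maxNorm z := by
  simp [maxNorm_eq_norm_ofLp, norm_smul, abs_of_nonneg hr]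

theorem maxNorm_le_norm (z : EuclideanSpace ℂ (Fin m)) : maxNorm z ≤ ‖z‖ :=
  Real.iSup_le (fun i => PiLp.norm_apply_le z i) (norm_nonneg _)

theorem exists_pos_le_norm_apply (z : EuclideanSpace ℂ (Fin m)) :
    ∃ c > 0, ∀ i ∈ nonzeroIndices z, c ≤ ‖z i‖ := by
  obtain h | h := (nonzeroIndices z).eq_empty_or_nonempty
  · exact ⟨1, one_pos, by simp [h]⟩
  · obtain ⟨i, hi, hmin⟩ := (nonzeroIndices z).exists_min_image (fun i => ‖z i‖) h
    exact ⟨‖z i‖, norm_pos_iff.2 (mem_nonzeroIndices.1 hi), hmin⟩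

/-- A continuous function on `ℂ^m` dominating the maximum norm attains its minimum on every leaf
in `S_A`, since the maximum norm is coercive along such a leaf. -/
theorem Admissible.exists_flow_isMin (hA : Admissible A) {z : EuclideanSpace ℂ (Fin m)}
    (hz : z ∈ siegelSet A) {N : EuclideanSpace ℂ (Fin m) → ℝ} (hN : Continuous N)
    (hle : ∀ w, maxNorm w ≤ N w) :
    ∃ T, ∀ S, N (flow A z T) ≤ N (flow A z S) := by
  obtain ⟨δ, hδ, h⟩ := hA.exists_mul_norm_le_inner
  obtain ⟨c, hc, hcz⟩ := exists_pos_le_norm_apply z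
  have hcont : Continuous fun T => N (flow A z T) :=
    hN.comp ((continuous_flow A).comp (by fun_prop : Continuous fun T => (z, T)))
  refine hcont.exists_forall_le (tendsto_atTop_mono (f := fun T => c * Real.exp (δ * ‖T‖)) ?_ ?_)
  · intro T
    obtain ⟨i, hi, hiT⟩ := h _ hz T
    calc c * Real.exp (δ * ‖T‖) ≤ ‖z i‖ * Real.exp (inner ℝ (A i) T) := by
          have := hcz i hi
          gcongr
      _ = ‖flow A z T i‖ := (norm_flow_apply A z T i).symm
      _ ≤ N (flow A z T) := (norm_apply_le_maxNorm _ i).trans (hle _)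
  · exact (Real.tendsto_exp_atTop.comp
      ((tendsto_norm_cocompact_atTop (E := EuclideanSpace ℝ (Fin d))).const_mul_atTop
        hδ)).const_mul_atTop hc

end Flow

/-! ### Points of the moment-angle complex in a leaf -/

section MomentAngle

variable {m d : ℕ} {A : Fin m → EuclideanSpace ℝ (Fin d)}

theorem mem_momentAngle_complex_iff {u : EuclideanSpace ℂ (Fin m)} :
    u ∈ momentAngle (complex A) ↔
      (∀ i, ‖u i‖ ≤ 1) ∧ 0 ∈ conv A {i | ‖u i‖ = 1} := by
  simp only [momentAngle, complex, Set.mem_iUnion, Set.mem_ofPred_eq, exists_prop]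
  constructor
  · rintro ⟨σ, hσ, h⟩
    refine ⟨fun i => ?_, conv_mono A (fun i hi => ?_) hσ⟩
    · by_cases hi : i ∈ σ
      · exact (h i).1 hi
      · exact ((h i).2 hi).le
    · simpa using (h i).2 (by simpa using hi)
  · rintro ⟨h1, h0⟩
    refine ⟨({i | ‖u i‖ = 1} : Finset (Fin m))ᶜ, by rwa [compl_compl], fun i => ⟨fun _ => h1 i, ?_⟩⟩
    simp

theorem momentAngle_complex_subset_siegelSet : momentAngle (complex A) ⊆ siegelSet A := by
  intro u hu
  refine conv_mono A (fun i hi => ?_) (mem_momentAngle_complex_iff.1 hu).2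
  rw [mem_nonzeroIndices, ← norm_pos_iff]
  simp_all

theorem maxNorm_eq_one_of_mem_momentAngle {u : EuclideanSpace ℂ (Fin m)}
    (hu : u ∈ momentAngle (complex A)) : maxNorm u = 1 := by
  obtain ⟨h1, h0⟩ := mem_momentAngle_complex_iff.1 hu
  obtain ⟨i, hi⟩ := nonempty_of_zero_mem_conv h0
  refine le_antisymm (Real.iSup_le h1 zero_le_one) ?_
  simpa [(Finset.mem_filter.1 hi).2] using norm_apply_le_maxNorm u i

theorem Admissible.maxNorm_lt_maxNorm_flow (hA : Admissible A) {u : EuclideanSpace ℂ (Fin m)}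
    (hu : u ∈ momentAngle (complex A)) {S : EuclideanSpace ℝ (Fin d)} (hS : S ≠ 0) :
    maxNorm u < maxNorm (flow A u S) := by
  obtain ⟨i, hi, h⟩ := hA.exists_inner_pos (mem_momentAngle_complex_iff.1 hu).2 hS
  rw [maxNorm_eq_one_of_mem_momentAngle hu]
  refine lt_of_lt_of_le ?_ (norm_apply_le_maxNorm _ i)
  rw [norm_flow_apply, (Finset.mem_filter.1 hi).2, one_mul]
  exact Real.one_lt_exp_iff.2 h

/-- At a minimum of the maximum norm along a leaf the vectors `A_i` of the largest entries surround
the origin: otherwise a separating direction would decrease all the largest entries at once. -/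
theorem inv_maxNorm_smul_mem_momentAngle (hm : 0 < m) {w : EuclideanSpace ℂ (Fin m)}
    (hw : 0 < maxNorm w) (hmin : ∀ S, maxNorm w ≤ maxNorm (flow A w S)) :
    (maxNorm w)⁻¹ • w ∈ momentAngle (complex A) := by
  have hnorm : ∀ i, ‖((maxNorm w)⁻¹ • w) i‖ = (maxNorm w)⁻¹ * ‖w i‖ := fun i => by
    simp [abs_of_pos hw]
  refine mem_momentAngle_complex_iff.2 ⟨fun i => ?_, ?_⟩
  · rw [hnorm, inv_mul_le_one₀ hw]
    exact norm_apply_le_maxNorm w i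
  · by_contra h0
    obtain ⟨S, hS⟩ := exists_inner_neg_of_zero_notMem_conv h0
    have hev : ∀ᶠ t : ℝ in 𝓝[>] 0, ∀ i, ‖flow A w (t • S) i‖ < maxNorm w := by
      refine eventually_all.2 fun i => ?_
      obtain hi | hi := (norm_apply_le_maxNorm w i).eq_or_lt
      · have hiS : inner ℝ (A i) S < 0 := hS i (Finset.mem_filter.2 ⟨Finset.mem_univ i, by
          rw [hnorm, hi, inv_mul_cancel₀ hw.ne']⟩)
        filter_upwards [self_mem_nhdsWithin] with t ht
        rw [norm_flow_apply, hi, inner_smul_right]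
        exact mul_lt_of_lt_one_right hw (Real.exp_lt_one_iff.2 (mul_neg_of_pos_of_neg ht hiS))
      · have hc : Continuous fun t : ℝ => ‖flow A w (t • S) i‖ := by
          simp_rw [flow_apply]
          fun_prop
        refine nhdsWithin_le_nhds (hc.continuousAt.eventually_lt_const ?_)
        simpa using hi
    obtain ⟨t, ht⟩ := hev.exists
    obtain ⟨i, hi⟩ := exists_norm_apply_eq_maxNorm hm (flow A w (t • S))
    exact (ht i).not_ge (hi ▸ hmin _)

end MomentAngle

/-! ### Points of the link in a leaf -/

section Link

variable {m d : ℕ} {A : Fin m → EuclideanSpace ℝ (Fin d)}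

theorem norm_flow_sq (z : EuclideanSpace ℂ (Fin m)) (T : EuclideanSpace ℝ (Fin d)) :
    ‖flow A z T‖ ^ 2 = ∑ i, ‖z i‖ ^ 2 * Real.exp (2 * inner ℝ (A i) T) := by
  rw [EuclideanSpace.norm_sq_eq]
  refine Finset.sum_congr rfl fun i _ => ?_
  rw [norm_flow_apply, mul_pow, ← Real.exp_nat_mul, Nat.cast_ofNat]

theorem link_subset_siegelSet : link A ⊆ siegelSet A := by
  rintro z ⟨h0, h1⟩
  have hz : ∀ i ∉ nonzeroIndices z, z i = 0 := fun i hi => by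
    simpa [mem_nonzeroIndices] using hi
  refine zero_mem_conv_of_sum (w := fun i => ‖z i‖ ^ 2) (fun i _ => by positivity) ?_ ?_
  · rw [Finset.sum_subset (Finset.subset_univ _) fun i _ hi => by simp [hz i hi],
      ← EuclideanSpace.norm_sq_eq, h1, one_pow]
  · rw [Finset.sum_subset (Finset.subset_univ _) fun i _ hi => by simp [hz i hi], h0]

theorem isCompact_link : IsCompact (link A) := by
  refine Metric.isCompact_of_isClosed_isBounded ?_ ?_
  · exact (isClosed_eq (by fun_prop) continuous_const).inter
      (isClosed_eq continuous_norm continuous_const)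
  · exact Metric.isBounded_sphere.subset fun z hz => mem_sphere_zero_iff_norm.2 hz.2

/-- The squared norm along the leaf is a sum of exponentials; comparing each with its tangent at the
origin, the linear terms cancel by the equation of the link. -/
theorem Admissible.norm_lt_norm_flow (hA : Admissible A) {u : EuclideanSpace ℂ (Fin m)}
    (hu : u ∈ link A) {S : EuclideanSpace ℝ (Fin d)} (hS : S ≠ 0) :
    ‖u‖ < ‖flow A u S‖ := by
  refine lt_of_pow_lt_pow_left₀ 2 (norm_nonneg _) ?_
  obtain ⟨i, hi, hiS⟩ := hA.exists_inner_pos (link_subset_siegelSet hu) hS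
  have hlin : ∑ i, ‖u i‖ ^ 2 * inner ℝ (A i) S = 0 := by
    have := congrArg (fun x => inner ℝ x S) hu.1
    simpa [sum_inner, real_inner_smul_left] using this
  have hsq : ‖u‖ ^ 2 = ∑ i, ‖u i‖ ^ 2 * (2 * inner ℝ (A i) S + 1) := by
    simp_rw [mul_add, mul_left_comm _ (2 : ℝ), Finset.sum_add_distrib, ← Finset.mul_sum, hlin,
      mul_one, EuclideanSpace.norm_sq_eq]
    ring
  rw [hsq, norm_flow_sq]
  refine Finset.sum_lt_sum (fun j _ => ?_) ⟨i, Finset.mem_univ i, ?_⟩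
  · exact mul_le_mul_of_nonneg_left (Real.add_one_le_exp _) (by positivity)
  · have := norm_pos_iff.2 (mem_nonzeroIndices.1 hi)
    exact mul_lt_mul_of_pos_left (Real.add_one_lt_exp (by linarith)) (by positivity)

theorem inv_norm_smul_mem_link {w : EuclideanSpace ℂ (Fin m)} (hw : w ≠ 0)
    (hmin : ∀ S, ‖w‖ ≤ ‖flow A w S‖) : ‖w‖⁻¹ • w ∈ link A := by
  -- `2 • S` is the gradient at `0` of `T ↦ ‖flow A w T‖ ^ 2`, so the derivative in direction `S` is
  -- `2 * ‖S‖ ^ 2`.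
  set S := ∑ i, ‖w i‖ ^ 2 • A i with hSdef
  have hder : HasDerivAt (fun t : ℝ => ∑ i, ‖w i‖ ^ 2 * Real.exp (2 * inner ℝ (A i) (t • S)))
      (∑ i, ‖w i‖ ^ 2 * (2 * inner ℝ (A i) S)) 0 := by
    refine HasDerivAt.fun_sum fun i _ => HasDerivAt.const_mul _ ?_
    have h := ((hasDerivAt_id (0 : ℝ)).mul_const (2 * inner ℝ (A i) S)).exp
    simp only [id, zero_mul, Real.exp_zero, one_mul] at h
    refine h.congr_of_eventuallyEq (Eventually.of_forall fun t => ?_)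
    simp only [inner_smul_right]
    congr 1
    ring
  have hloc : IsLocalMin
      (fun t : ℝ => ∑ i, ‖w i‖ ^ 2 * Real.exp (2 * inner ℝ (A i) (t • S))) 0 := by
    refine Eventually.of_forall fun t => ?_
    simp only [← norm_flow_sq, zero_smul, flow_zero]
    exact pow_le_pow_left₀ (norm_nonneg _) (hmin _) 2
  have h0 : S = 0 := by
    have h := hloc.hasDerivAt_eq_zero hder
    simp_rw [mul_left_comm _ (2 : ℝ), ← Finset.mul_sum, ← real_inner_smul_left, ← sum_inner,
      ← hSdef] at h
    simpa using h
  refine ⟨?_, by simp [norm_smul, hw]⟩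
  have : ∀ i, ‖(‖w‖⁻¹ • w) i‖ ^ 2 • A i = (‖w‖⁻¹) ^ 2 • (‖w i‖ ^ 2 • A i) := fun i => by
    simp [mul_pow, smul_smul]
  simp_rw [this, ← Finset.smul_sum, ← hSdef, h0, smul_zero]

end Link

/-! ### The distinguished points of a leaf -/

section Distinguished

variable {m d : ℕ} {A : Fin m → EuclideanSpace ℝ (Fin d)}

/-- If the positively homogeneous function `N` strictly grows along leaves away from the points of
`P`, then flowing between two points of `P`, up to positive scalars, takes no time. Otherwise `N`
would grow strictly both from `r • u` to `r' • u'` and back. -/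
theorem eq_zero_of_smul_eq_smul_flow {N : EuclideanSpace ℂ (Fin m) → ℝ}
    (hN : ∀ r : ℝ, 0 ≤ r → ∀ z, N (r • z) = r * N z) {P : Set (EuclideanSpace ℂ (Fin m))}
    (hP : ∀ u ∈ P, ∀ S ≠ 0, N u < N (flow A u S)) {u u' : EuclideanSpace ℂ (Fin m)}
    (hu : u ∈ P) (hu' : u' ∈ P) {r r' : ℝ} (hr : 0 < r) (hr' : 0 < r')
    {S : EuclideanSpace ℝ (Fin d)} (h : r' • u' = r • flow A u S) : S = 0 := by
  by_contra hS
  have hinv : r • u = r' • flow A u' (-S) := by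
    rw [← flow_smul, h, flow_smul, flow_flow, add_neg_cancel, flow_zero]
  have h1 := hP u hu S hS
  have h2 := hP u' hu' (-S) (neg_ne_zero.2 hS)
  rw [← mul_lt_mul_iff_right₀ hr, ← hN r hr.le, ← hN r hr.le, ← h, hN r' hr'.le, hN r hr.le] at h1
  rw [← mul_lt_mul_iff_right₀ hr', ← hN r' hr'.le (flow A _ _), ← hinv, hN r hr.le] at h2
  exact lt_asymm h1 h2

theorem Admissible.isNormMin_smul_flow_iff (hA : Admissible A) {u : EuclideanSpace ℂ (Fin m)}
    (hu : u ∈ link A) (T : EuclideanSpace ℝ (Fin d)) {r : ℝ} (hr : 0 < r)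
    {w : EuclideanSpace ℂ (Fin m)} : IsNormMin A (r • flow A u T) w ↔ w = r • u := by
  have hself : r • u ∈ leaf A (r • flow A u T) :=
    ⟨-T, by rw [flow_smul, flow_flow, add_neg_cancel, flow_zero]⟩
  have hle : ∀ S, ‖u‖ ≤ ‖flow A u S‖ := fun S => by
    obtain rfl | hS := eq_or_ne S 0
    · simp
    · exact (hA.norm_lt_norm_flow hu hS).le
  constructor
  · rintro ⟨⟨S, rfl⟩, hmin⟩
    have h := hmin _ hself
    rw [flow_smul, flow_flow] at h ⊢
    rw [norm_smul, norm_smul, mul_le_mul_iff_right₀ (norm_pos_iff.2 hr.ne')] at h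
    by_cases hS : T + S = 0
    · rw [hS, flow_zero]
    · exact absurd h (hA.norm_lt_norm_flow hu hS).not_ge
  · rintro rfl
    refine ⟨hself, ?_⟩
    rintro _ ⟨S, rfl⟩
    rw [flow_smul, flow_flow, norm_smul, norm_smul]
    exact mul_le_mul_of_nonneg_left (hle _) (norm_nonneg _)

theorem Admissible.isMomentAnglePoint_smul_flow_iff (hA : Admissible A)
    {u : EuclideanSpace ℂ (Fin m)} (hu : u ∈ momentAngle (complex A))
    (T : EuclideanSpace ℝ (Fin d)) {r : ℝ} (hr : 0 < r) {w : EuclideanSpace ℂ (Fin m)} :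
    IsMomentAnglePoint A (r • flow A u T) w ↔ w = r • u := by
  constructor
  · rintro ⟨⟨S, rfl⟩, hw⟩
    rw [flow_smul, flow_flow] at hw ⊢
    set v := r • flow A u (T + S) with hv
    have hpos : 0 < maxNorm v := by
      refine (Real.iSup_nonneg fun i => norm_nonneg _).lt_of_ne fun h => ?_
      have := maxNorm_eq_one_of_mem_momentAngle hw
      rw [show maxNorm v = 0 from h.symm] at this
      simp [maxNorm] at this
    have hS := eq_zero_of_smul_eq_smul_flow (fun _ => maxNorm_smul)
      (fun _ h _ => hA.maxNorm_lt_maxNorm_flow h) hu hw hr hpos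
      (by rw [smul_inv_smul₀ hpos.ne'])
    rw [hv, hS, flow_zero]
  · rintro rfl
    refine ⟨⟨-T, by rw [flow_smul, flow_flow, add_neg_cancel, flow_zero]⟩, ?_⟩
    rwa [maxNorm_smul hr.le, maxNorm_eq_one_of_mem_momentAngle hu, mul_one, inv_smul_smul₀ hr.ne']

theorem Admissible.normMin_smul_flow (hA : Admissible A) {u : EuclideanSpace ℂ (Fin m)}
    (hu : u ∈ link A) (T : EuclideanSpace ℝ (Fin d)) {r : ℝ} (hr : 0 < r) :
    normMin A (r • flow A u T) = r • u :=
  (hA.isNormMin_smul_flow_iff hu T hr).1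
    (Classical.epsilon_spec ⟨_, (hA.isNormMin_smul_flow_iff hu T hr).2 rfl⟩)

theorem Admissible.momentAnglePoint_smul_flow (hA : Admissible A) {u : EuclideanSpace ℂ (Fin m)}
    (hu : u ∈ momentAngle (complex A)) (T : EuclideanSpace ℝ (Fin d)) {r : ℝ} (hr : 0 < r) :
    momentAnglePoint A (r • flow A u T) = r • u :=
  (hA.isMomentAnglePoint_smul_flow_iff hu T hr).1
    (Classical.epsilon_spec ⟨_, (hA.isMomentAnglePoint_smul_flow_iff hu T hr).2 rfl⟩)

theorem maxNorm_pos_of_mem_siegelSet {z : EuclideanSpace ℂ (Fin m)} (hz : z ∈ siegelSet A) :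
    0 < maxNorm z := by
  obtain ⟨i, hi⟩ := nonempty_of_zero_mem_conv hz
  exact (norm_pos_iff.2 (mem_nonzeroIndices.1 hi)).trans_le (norm_apply_le_maxNorm z i)

theorem flow_mem_siegelSet {z : EuclideanSpace ℂ (Fin m)} (hz : z ∈ siegelSet A)
    (T : EuclideanSpace ℝ (Fin d)) : flow A z T ∈ siegelSet A := by
  simpa using smul_flow_mem_siegelSet hz T one_pos

theorem Admissible.exists_eq_smul_flow_of_momentAngle (hA : Admissible A)
    {z : EuclideanSpace ℂ (Fin m)} (hz : z ∈ siegelSet A) :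
    ∃ u ∈ momentAngle (complex A), ∃ T, ∃ r : ℝ, 0 < r ∧ z = r • flow A u T := by
  obtain ⟨i, -⟩ := nonempty_of_zero_mem_conv hz
  obtain ⟨T, hT⟩ := hA.exists_flow_isMin hz continuous_maxNorm fun _ => le_rfl
  have hpos := maxNorm_pos_of_mem_siegelSet (flow_mem_siegelSet hz T)
  refine ⟨_, inv_maxNorm_smul_mem_momentAngle i.pos hpos (A := A) fun S => ?_,
    -T, _, hpos, ?_⟩
  · rw [flow_flow]
    exact hT _
  · rw [flow_smul, smul_inv_smul₀ hpos.ne', flow_flow, add_neg_cancel, flow_zero]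

theorem Admissible.exists_eq_smul_flow_of_link (hA : Admissible A)
    {z : EuclideanSpace ℂ (Fin m)} (hz : z ∈ siegelSet A) :
    ∃ u ∈ link A, ∃ T, ∃ r : ℝ, 0 < r ∧ z = r • flow A u T := by
  obtain ⟨T, hT⟩ := hA.exists_flow_isMin hz continuous_norm maxNorm_le_norm
  have hpos : 0 < ‖flow A z T‖ :=
    (maxNorm_pos_of_mem_siegelSet (flow_mem_siegelSet hz T)).trans_le (maxNorm_le_norm _)
  refine ⟨_, inv_norm_smul_mem_link (norm_pos_iff.1 hpos) (A := A) fun S => ?_, -T, _, hpos, ?_⟩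
  · rw [flow_flow]
    exact hT _
  · rw [flow_smul, smul_inv_smul₀ hpos.ne', flow_flow, add_neg_cancel, flow_zero]

end Distinguished

/-! ### The homeomorphisms -/

section Homeomorphism

variable {m d : ℕ} {A : Fin m → EuclideanSpace ℝ (Fin d)}

theorem isCompact_momentAngle (K : Set (Finset (Fin m))) : IsCompact (momentAngle K) := by
  refine Metric.isCompact_of_isClosed_isBounded ?_ ?_
  · refine K.toFinite.isClosed_biUnion fun σ _ => ?_
    rw [Set.ofPred_forall]
    refine isClosed_iInter fun i => ?_
    by_cases hi : i ∈ σ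
    · simpa [hi] using isClosed_le (by fun_prop : Continuous fun z : EuclideanSpace ℂ (Fin m) =>
        ‖z i‖) continuous_const
    · simpa [hi] using isClosed_eq (by fun_prop : Continuous fun z : EuclideanSpace ℂ (Fin m) =>
        ‖z i‖) continuous_const
  · refine (Metric.isBounded_closedBall (x := 0) (r := √m)).subset fun z hz => ?_
    obtain ⟨σ, -, hz⟩ := Set.mem_iUnion₂.1 hz
    have hz1 : ∀ i, ‖z i‖ ≤ 1 := fun i => by
      by_cases hi : i ∈ σ
      · exact (hz i).1 hi
      · exact ((hz i).2 hi).le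
    rw [mem_closedBall_zero_iff, EuclideanSpace.norm_eq]
    refine Real.sqrt_le_sqrt ?_
    calc ∑ i, ‖z i‖ ^ 2 ≤ ∑ _i : Fin m, (1 : ℝ) :=
          Finset.sum_le_sum fun i _ => pow_le_one₀ (norm_nonneg _) (hz1 i)
      _ = m := by simp

/-- If `z = r F(u, T)` with `u` in the moment-angle complex, then one of the entries of `u` of
modulus `1` is expanded by at least `exp (δ ‖T‖)`, while one of the entries of `z` that do not
vanish near `z₀` is contracted at least as much. As the entries of `z` are bounded, and those
non-vanishing ones bounded away from `0`, this confines both `r` and `T`. -/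
theorem Admissible.eventually_bounded (hA : Admissible A) {z₀ : EuclideanSpace ℂ (Fin m)}
    (hz₀ : z₀ ∈ siegelSet A) :
    ∃ a b R : ℝ, 0 < a ∧ ∀ᶠ z in 𝓝 z₀, ∀ u ∈ momentAngle (complex A), ∀ T, ∀ r > 0,
      z = r • flow A u T → r ∈ Set.Icc a b ∧ ‖T‖ ≤ R := by
  obtain ⟨δ, hδ, h⟩ := hA.exists_mul_norm_le_inner
  obtain ⟨c, hc, hcz⟩ := exists_pos_le_norm_apply z₀
  set C := maxNorm z₀ + 1
  refine ⟨c / 2, C, C / (c / 2) / δ, by positivity, ?_⟩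
  have h1 : ∀ᶠ z in 𝓝 z₀, maxNorm z < C :=
    continuous_maxNorm.continuousAt.eventually_lt_const (lt_add_one _)
  have h2 : ∀ᶠ z : EuclideanSpace ℂ (Fin m) in 𝓝 z₀,
      ∀ i, i ∈ nonzeroIndices z₀ → c / 2 < ‖z i‖ := by
    refine eventually_all.2 fun i => ?_
    by_cases hi : i ∈ nonzeroIndices z₀
    · have hcont : Continuous fun z : EuclideanSpace ℂ (Fin m) => ‖z i‖ := by fun_prop
      have hlt : c / 2 < ‖z₀ i‖ := (half_lt_self hc).trans_le (hcz i hi)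
      exact (hcont.continuousAt.eventually_const_lt hlt).mono fun _ h _ => h
    · simp [hi]
  filter_upwards [h1, h2] with z hzC hzc u hu T r hr hz
  have hnorm : ∀ i, ‖z i‖ = r * (‖u i‖ * Real.exp (inner ℝ (A i) T)) := fun i => by
    rw [hz, PiLp.smul_apply, norm_smul, norm_flow_apply, Real.norm_of_nonneg hr.le]
  obtain ⟨hu1, hu0⟩ := mem_momentAngle_complex_iff.1 hu
  have hup : r * Real.exp (δ * ‖T‖) < C := by
    obtain ⟨i, hi, hiT⟩ := h _ hu0 T
    refine lt_of_le_of_lt ?_ ((norm_apply_le_maxNorm z i).trans_lt hzC)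
    rw [hnorm, (Finset.mem_filter.1 hi).2, one_mul]
    gcongr
  have hlow : c / 2 * Real.exp (δ * ‖T‖) < r := by
    obtain ⟨i, hi, hiT⟩ := h _ hz₀ (-T)
    rw [norm_neg, inner_neg_right] at hiT
    have hlt : c / 2 < r * Real.exp (-(δ * ‖T‖)) := by
      refine (hzc i hi).trans_le ?_
      rw [hnorm]
      refine mul_le_mul_of_nonneg_left ?_ hr.le
      refine (mul_le_of_le_one_left (Real.exp_pos _).le (hu1 i)).trans (Real.exp_le_exp.2 ?_)
      linarith
    rwa [Real.exp_neg, ← div_eq_mul_inv, lt_div_iff₀ (Real.exp_pos _)] at hlt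
  have hE : δ * ‖T‖ + 1 ≤ Real.exp (δ * ‖T‖) := Real.add_one_le_exp _
  have hE1 : 1 ≤ Real.exp (δ * ‖T‖) := Real.one_le_exp (by positivity)
  have hrC : r ≤ C := (le_mul_of_one_le_right hr.le hE1).trans hup.le
  refine ⟨⟨(le_mul_of_one_le_right (by positivity) hE1).trans hlow.le, hrC⟩, ?_⟩
  rw [le_div_iff₀ hδ, le_div_iff₀ (by positivity)]
  calc ‖T‖ * δ * (c / 2) = c / 2 * (δ * ‖T‖) := by ring
    _ ≤ c / 2 * Real.exp (δ * ‖T‖) := by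
        gcongr
        linarith
    _ ≤ C := hlow.le.trans hrC

variable (A) in
/-- The map `(z, T, r) ↦ r F(z, T)` from the moment-angle complex times `ℝ^d × ℝ_{>0}` to
`S_A`. -/
noncomputable def momentAngleFlow
    (p : momentAngle (complex A) × EuclideanSpace ℝ (Fin d) × Set.Ioi (0 : ℝ)) :
    siegelSet A :=
  ⟨(p.2.2 : ℝ) • flow A p.1 p.2.1,
    smul_flow_mem_siegelSet (momentAngle_complex_subset_siegelSet p.1.2) _ p.2.2.2⟩

theorem continuous_momentAngleFlow : Continuous (momentAngleFlow A) := by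
  refine Continuous.subtype_mk ?_ _
  have h : Continuous fun p : momentAngle (complex A) × EuclideanSpace ℝ (Fin d) ×
      Set.Ioi (0 : ℝ) => flow A p.1 p.2.1 :=
    (continuous_flow A).comp ((continuous_subtype_val.comp continuous_fst).prodMk
      (continuous_fst.comp continuous_snd))
  exact (continuous_subtype_val.comp (continuous_snd.comp continuous_snd)).smul h

theorem Admissible.bijective_momentAngleFlow (hA : Admissible A) :
    Function.Bijective (momentAngleFlow A) := by
  constructor
  · rintro ⟨⟨u, hu⟩, T, ⟨r, hr⟩⟩ ⟨⟨u', hu'⟩, T', ⟨r', hr'⟩⟩ h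
    replace h : r • flow A u T = r' • flow A u' T' := congrArg Subtype.val h
    rw [Set.mem_Ioi] at hr hr'
    have hru : r • u = r' • u' := by
      rw [← hA.momentAnglePoint_smul_flow hu T hr, h, hA.momentAnglePoint_smul_flow hu' T' hr']
    have hrr : r = r' := by
      have := congrArg maxNorm hru
      rwa [maxNorm_smul hr.le, maxNorm_smul hr'.le, maxNorm_eq_one_of_mem_momentAngle hu,
        maxNorm_eq_one_of_mem_momentAngle hu', mul_one, mul_one] at this
    subst hrr
    obtain rfl : u = u' := smul_right_injective _ hr.ne' hru
    have hTT : T - T' = 0 := by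
      refine eq_zero_of_smul_eq_smul_flow (A := A) (fun _ => maxNorm_smul)
        (fun _ h _ => hA.maxNorm_lt_maxNorm_flow h) hu hu hr hr ?_
      rw [sub_eq_add_neg, ← flow_flow, ← flow_smul, h, flow_smul, flow_flow, add_neg_cancel,
        flow_zero]
    rw [sub_eq_zero.1 hTT]
  · rintro ⟨z, hz⟩
    obtain ⟨u, hu, T, r, hr, h⟩ := hA.exists_eq_smul_flow_of_momentAngle hz
    exact ⟨⟨⟨u, hu⟩, T, ⟨r, hr⟩⟩, Subtype.ext h.symm⟩

theorem Admissible.isProperMap_momentAngleFlow (hA : Admissible A) :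
    IsProperMap (momentAngleFlow A) := by
  refine isProperMap_iff_ultrafilter_of_t2.2 ⟨continuous_momentAngleFlow, fun 𝒰 z₀ h𝒰 => ?_⟩
  obtain ⟨a, b, R, ha, hev⟩ := hA.eventually_bounded z₀.2
  have : CompactSpace (momentAngle (complex A)) :=
    isCompact_iff_compactSpace.1 (isCompact_momentAngle _)
  have hK : IsCompact ((Set.univ : Set (momentAngle (complex A))) ×ˢ
      (Metric.closedBall (0 : EuclideanSpace ℝ (Fin d)) R ×ˢ
        ((↑) ⁻¹' Set.Icc a b : Set (Set.Ioi (0 : ℝ))))) := by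
    refine isCompact_univ.prod ((isCompact_closedBall _ _).prod ?_)
    refine Topology.IsInducing.subtypeVal.isCompact_preimage' isCompact_Icc fun x hx => ?_
    exact ⟨⟨x, ha.trans_le hx.1⟩, rfl⟩
  have hmem : ∀ᶠ p in (𝒰 : Filter _), p ∈ (Set.univ : Set (momentAngle (complex A))) ×ˢ
      (Metric.closedBall (0 : EuclideanSpace ℝ (Fin d)) R ×ˢ
        ((↑) ⁻¹' Set.Icc a b : Set (Set.Ioi (0 : ℝ)))) := by
    filter_upwards [(continuous_subtype_val.tendsto z₀).comp h𝒰 hev] with p hp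
    obtain ⟨hr, hT⟩ := hp p.1 p.1.2 p.2.1 p.2.2 p.2.2.2 rfl
    exact ⟨Set.mem_univ _, mem_closedBall_zero_iff.2 hT, hr⟩
  obtain ⟨x, -, hx⟩ := hK.ultrafilter_le_nhds 𝒰 (le_principal_iff.2 hmem)
  exact ⟨x, hx⟩

/-- The homeomorphism from the moment-angle complex times `ℝ^d × ℝ_{>0}` to `S_A`. -/
noncomputable def Admissible.momentAngleHomeomorph (hA : Admissible A) :
    (momentAngle (complex A) × EuclideanSpace ℝ (Fin d) × Set.Ioi (0 : ℝ)) ≃ₜ siegelSet A :=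
  (isHomeomorph_iff_continuous_isClosedMap_bijective.2 ⟨continuous_momentAngleFlow,
    hA.isProperMap_momentAngleFlow.isClosedMap, hA.bijective_momentAngleFlow⟩).homeomorph _

theorem Admissible.coe_momentAngleHomeomorph (hA : Admissible A)
    (p : momentAngle (complex A) × EuclideanSpace ℝ (Fin d) × Set.Ioi (0 : ℝ)) :
    (hA.momentAngleHomeomorph p : EuclideanSpace ℂ (Fin m)) = (p.2.2 : ℝ) • flow A p.1 p.2.1 :=
  rfl

theorem Admissible.coe_fst_momentAngleHomeomorph_symm (hA : Admissible A) (z : siegelSet A) :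
    ((hA.momentAngleHomeomorph.symm z).1 : EuclideanSpace ℂ (Fin m)) =
      (maxNorm (momentAnglePoint A z))⁻¹ • momentAnglePoint A z := by
  obtain ⟨p, rfl⟩ := hA.momentAngleHomeomorph.surjective z
  have hr : (0 : ℝ) < p.2.2 := p.2.2.2
  rw [Homeomorph.symm_apply_apply, hA.coe_momentAngleHomeomorph,
    hA.momentAnglePoint_smul_flow p.1.2 _ hr, maxNorm_smul hr.le,
    maxNorm_eq_one_of_mem_momentAngle p.1.2, mul_one, inv_smul_smul₀ hr.ne']

theorem Admissible.inv_norm_smul_normMin_smul_flow (hA : Admissible A)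
    {u : EuclideanSpace ℂ (Fin m)} (hu : u ∈ link A) (T : EuclideanSpace ℝ (Fin d)) {r : ℝ}
    (hr : 0 < r) :
    ‖normMin A (r • flow A u T)‖⁻¹ • normMin A (r • flow A u T) = u := by
  rw [hA.normMin_smul_flow hu T hr, norm_smul, hu.2, mul_one, Real.norm_of_nonneg hr.le,
    inv_smul_smul₀ hr.ne']

theorem Admissible.inv_norm_smul_normMin_mem_link (hA : Admissible A)
    {z : EuclideanSpace ℂ (Fin m)} (hz : z ∈ siegelSet A) :
    ‖normMin A z‖⁻¹ • normMin A z ∈ link A := by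
  obtain ⟨u, hu, T, r, hr, rfl⟩ := hA.exists_eq_smul_flow_of_link hz
  rwa [hA.inv_norm_smul_normMin_smul_flow hu T hr]

theorem eq_inv_smul_flow_neg {u z : EuclideanSpace ℂ (Fin m)} {T : EuclideanSpace ℝ (Fin d)}
    {r : ℝ} (hr : 0 < r) (h : z = r • flow A u T) : u = r⁻¹ • flow A z (-T) := by
  rw [h, flow_smul, flow_flow, add_neg_cancel, flow_zero, inv_smul_smul₀ hr.ne']

/-- The bijection between the link and the moment-angle complex: both are sections of the
partition of `S_A` into the sets `{r F(z, T) | r > 0}`. -/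
noncomputable def Admissible.linkEquivMomentAngle (hA : Admissible A) :
    link A ≃ momentAngle (complex A) where
  toFun x := (hA.momentAngleHomeomorph.symm ⟨x, link_subset_siegelSet x.2⟩).1
  invFun z := ⟨_, hA.inv_norm_smul_normMin_mem_link (momentAngle_complex_subset_siegelSet z.2)⟩
  left_inv x := by
    obtain ⟨p, hp⟩ := hA.momentAngleHomeomorph.surjective ⟨x, link_subset_siegelSet x.2⟩
    have hr : (0 : ℝ) < p.2.2 := p.2.2.2
    have h := eq_inv_smul_flow_neg hr (congrArg Subtype.val hp).symm
    refine Subtype.ext ?_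
    simp only [← hp, Homeomorph.symm_apply_apply]
    rw [h]
    exact hA.inv_norm_smul_normMin_smul_flow x.2 _ (inv_pos.2 hr)
  right_inv z := by
    obtain ⟨u, hu, T, r, hr, h⟩ :=
      hA.exists_eq_smul_flow_of_link (momentAngle_complex_subset_siegelSet z.2)
    refine Subtype.ext ?_
    rw [hA.coe_fst_momentAngleHomeomorph_symm]
    have hu' : ‖normMin A z‖⁻¹ • normMin A z = r⁻¹ • flow A z (-T) := by
      rw [← eq_inv_smul_flow_neg hr h, h, hA.inv_norm_smul_normMin_smul_flow hu T hr]
    simp only [hu']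
    rw [hA.momentAnglePoint_smul_flow z.2 _ (inv_pos.2 hr), maxNorm_smul (inv_pos.2 hr).le,
      maxNorm_eq_one_of_mem_momentAngle z.2, mul_one, inv_smul_smul₀ (inv_pos.2 hr).ne']

theorem Admissible.continuous_linkEquivMomentAngle (hA : Admissible A) :
    Continuous hA.linkEquivMomentAngle :=
  continuous_fst.comp (hA.momentAngleHomeomorph.symm.continuous.comp
    (continuous_subtype_val.subtype_mk _))

end Homeomorphism

end SiegelLeaves

theorem mainTheorem2 {m d : ℕ} (hmd : d < m) (A : Fin m → EuclideanSpace ℝ (Fin d))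
    (hA : SiegelLeaves.Admissible A) (hc : SiegelLeaves.Centered A) :
    -- the functions `f_2` and `f_∞` are well defined on `S_A`
    (∀ z ∈ SiegelLeaves.siegelSet A,
      (∃! w, SiegelLeaves.IsNormMin A z w) ∧ 0 < ‖SiegelLeaves.normMin A z‖ ∧
      (∃! w, SiegelLeaves.IsMomentAnglePoint A z w)) ∧
    -- `f_2 / ‖f_2‖_2` restricts to a homeomorphism, with inverse `f_∞ / ‖f_∞‖_∞`
    SiegelLeaves.momentAngle (SiegelLeaves.complex A) ⊆ SiegelLeaves.siegelSet A ∧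
    (∃ e : SiegelLeaves.momentAngle (SiegelLeaves.complex A) ≃ₜ SiegelLeaves.link A,
      (∀ z, (e z : EuclideanSpace ℂ (Fin m)) =
        ‖SiegelLeaves.normMin A z‖⁻¹ • SiegelLeaves.normMin A z) ∧
      (∀ x, (e.symm x : EuclideanSpace ℂ (Fin m)) =
        (SiegelLeaves.maxNorm (SiegelLeaves.momentAnglePoint A x))⁻¹ •
          SiegelLeaves.momentAnglePoint A x)) ∧
    -- `Φ_A(∞)` is a homeomorphism onto `S_A`
    (∃ Φ : (SiegelLeaves.momentAngle (SiegelLeaves.complex A) ×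
        EuclideanSpace ℝ (Fin d) × Set.Ioi (0 : ℝ)) ≃ₜ SiegelLeaves.siegelSet A,
      ∀ z T r, (Φ (z, T, r) : EuclideanSpace ℂ (Fin m)) =
        (r : ℝ) • SiegelLeaves.flow A z T) := by
  refine ⟨fun z hz => ⟨?_, ?_, ?_⟩, SiegelLeaves.momentAngle_complex_subset_siegelSet, ?_,
    hA.momentAngleHomeomorph, fun z T r => hA.coe_momentAngleHomeomorph (z, T, r)⟩
  · obtain ⟨u, hu, T, r, hr, rfl⟩ := hA.exists_eq_smul_flow_of_link hz
    exact ⟨r • u, (hA.isNormMin_smul_flow_iff hu T hr).2 rfl,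
      fun w hw => (hA.isNormMin_smul_flow_iff hu T hr).1 hw⟩
  · obtain ⟨u, hu, T, r, hr, rfl⟩ := hA.exists_eq_smul_flow_of_link hz
    rw [hA.normMin_smul_flow hu T hr, norm_smul, hu.2, mul_one]
    exact norm_pos_iff.2 hr.ne'
  · obtain ⟨u, hu, T, r, hr, rfl⟩ := hA.exists_eq_smul_flow_of_momentAngle hz
    exact ⟨r • u, (hA.isMomentAnglePoint_smul_flow_iff hu T hr).2 rfl,
      fun w hw => (hA.isMomentAnglePoint_smul_flow_iff hu T hr).1 hw⟩
  · have : CompactSpace (SiegelLeaves.link A) :=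
      isCompact_iff_compactSpace.1 SiegelLeaves.isCompact_link
    refine ⟨(hA.continuous_linkEquivMomentAngle.homeoOfEquivCompactToT2).symm, fun z => rfl,
      fun x => ?_⟩
    exact hA.coe_fst_momentAngleHomeomorph_symm ⟨x, SiegelLeaves.link_subset_siegelSet x.2⟩
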